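/- For $N\ge 0$ let $\mathcal R_N\subset\mathbb R^{N+1}$ be the realizable set of the full-moment monomial basis on $[-1,1]$: the set of all vectors $u=(u_0,\dots,u_N)$ with $u_i=\int_{-1}^1\mu^i\,d\psi(\mu)$, $i=0,\dots,N$, for some finite nonnegative Borel measure $\psi$ on $[-1,1]$ with $\psi([-1,1])>0$. Put $$A(k)=(u_{i+j})_{i,j=0}^{k},\qquad B(k)=(u_{i+j+1})_{i,j=0}^{k},\qquad C(k)=(u_{i+j})_{i,j=1}^{k},$$ where $A(-1)$, $B(-1)$, $C(0)$ are empty matrices (and the corresponding quadratic forms are $0$), write $M\ge M'$ if $M-M'$ is positive semidefinite, and let $M^{+}$ denote the Moore--Penrose pseudoinverse of $M$. The Hankel conditions of order $m$ on $(u_0,\dots,u_m)$ are: $A(k)\ge B(k)$ and $A(k)\ge -B(k)$ if $m=2k+1$; $A(k)\ge 0$ and $A(k-1)\ge C(k)$ if $m=2k$. Define $$f_{\rm up}(u_0,\dots,u_N)=\begin{cases}u_{N-1}-b_-^T\,(A(k-1)-C(k))^{+}\,b_- & \text{if } N=2k+1,\\ u_N-b_-^T\,(A(k-1)-B(k-1))^{+}\,b_-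 & \text{if } N=2k,\end{cases}$$ $$f_{\rm low}(u_0,\dots,u_N)=\begin{cases}b_+^T\,A(k)^{+}\,b_+ & \text{if } N=2k+1,\\ -u_N+b_+^T\,(A(k-1)+B(k-1))^{+}\,b_+ & \text{if } N=2k,\end{cases}$$ where for $N=2k+1$ $$b_-=(u_k-u_{k+2},\dots,u_{N-2}-u_N)^T,\qquad b_+=(u_{k+1},\dots,u_N)^T,$$ and for $N=2k$ $$b_\mp=(u_k\mp u_{k+1},\dots,u_{N-1}\mp u_N)^T .$$ Let $u=(u_0,\dots,u_N)\in\mathcal R_N$. Then $f_{\rm low}(u)\le f_{\rm up}(u)$, and for every $u_{N+1}\in\mathbb R$ the following are equivalent: 1. $(u_0,\dots,u_N,u_{N+1})\in\mathcal R_{N+1}$; 2. $(u_0,\dots,u_{N+1})$ satisfies the Hankel conditions of order $N+1$; 3. $f_{\rm up}(u_0,\dots,u_N)\ge u_{N+1}\ge f_{\rm low}(u_0,\dots,u_N)$. -/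

import Mathlib

open MeasureTheory Matrix

noncomputable section

namespace FullMoment

/-! ### The Moore–Penrose pseudoinverse of a real square matrix -/

/-- The four Penrose equations: `X` is the Moore–Penrose pseudoinverse of `M`. -/
structure IsPseudoinverse {ι : Type*} [Fintype ι] (M X : Matrix ι ι ℝ) : Prop where
  mul_mul_left : M * X * M = M
  mul_mul_right : X * M * X = X
  symm_left : (M * X)ᵀ = M * X
  symm_right : (X * M)ᵀ = X * M

theorem IsPseudoinverse.unique {ι : Type*} [Fintype ι] {M X Y : Matrix ι ι ℝ}
    (hX : IsPseudoinverse M X) (hY : IsPseudoinverse M Y) : X = Y := by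
  have h1 : M * X = M * Y := by
    calc M * X = (M * X)ᵀ := hX.symm_left.symm
      _ = ((M * Y) * (M * X))ᵀ := by
          rw [← Matrix.mul_assoc, hY.mul_mul_left]
      _ = (M * X) * (M * Y) := by
          rw [Matrix.transpose_mul, hX.symm_left, hY.symm_left]
      _ = M * Y := by rw [← Matrix.mul_assoc, hX.mul_mul_left]
  have h2 : X * M = Y * M := by
    calc X * M = (X * M)ᵀ := hX.symm_right.symm
      _ = ((X * M) * (Y * M))ᵀ := by
          rw [Matrix.mul_assoc, ← Matrix.mul_assoc M, hY.mul_mul_left]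
      _ = (Y * M) * (X * M) := by
          rw [Matrix.transpose_mul, hX.symm_right, hY.symm_right]
      _ = Y * M := by
          rw [Matrix.mul_assoc, ← Matrix.mul_assoc M, hX.mul_mul_left]
  calc X = X * M * X := hX.mul_mul_right.symm
    _ = Y * M * X := by rw [h2]
    _ = Y * M * Y := by rw [Matrix.mul_assoc, h1, ← Matrix.mul_assoc]
    _ = Y := hY.mul_mul_right

theorem exists_isPseudoinverse_of_symm {ι : Type*} [Fintype ι] {S : Matrix ι ι ℝ}
    (hS : Sᵀ = S) : ∃ X, IsPseudoinverse S X ∧ Xᵀ = X := by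
  classical
  have hH : S.IsHermitian := by
    rw [Matrix.IsHermitian, Matrix.conjTranspose_eq_transpose_of_trivial, hS]
  obtain ⟨U, d, hU, hSd⟩ : ∃ (U : Matrix ι ι ℝ) (d : ι → ℝ),
      Uᵀ * U = 1 ∧ S = U * diagonal d * Uᵀ := by
    refine ⟨hH.eigenvectorUnitary, hH.eigenvalues, ?_, ?_⟩
    · have := Unitary.coe_star_mul_self hH.eigenvectorUnitary
      rwa [Matrix.star_eq_conjTranspose, Matrix.conjTranspose_eq_transpose_of_trivial] at this
    · have := hH.spectral_theorem
      rwa [Unitary.conjStarAlgAut_apply, Matrix.star_eq_conjTranspose,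
        Matrix.conjTranspose_eq_transpose_of_trivial] at this
  have key : ∀ e f : ι → ℝ, (U * diagonal e * Uᵀ) * (U * diagonal f * Uᵀ)
      = U * diagonal (fun i => e i * f i) * Uᵀ := by
    intro e f
    calc (U * diagonal e * Uᵀ) * (U * diagonal f * Uᵀ)
        = U * diagonal e * (Uᵀ * U) * diagonal f * Uᵀ := by simp only [Matrix.mul_assoc]
      _ = _ := by rw [hU, Matrix.mul_one, Matrix.mul_assoc U, Matrix.diagonal_mul_diagonal]
  have tr : ∀ e : ι → ℝ, (U * diagonal e * Uᵀ)ᵀ = U * diagonal e * Uᵀ := by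
    intro e
    simp [Matrix.transpose_mul, Matrix.mul_assoc]
  refine ⟨U * diagonal (fun i => (d i)⁻¹) * Uᵀ, ⟨?_, ?_, ?_, ?_⟩, tr _⟩
  · rw [hSd, key, key]
    congr 3
    funext i
    exact mul_inv_mul_cancel (d i)
  · rw [hSd, key, key]
    congr 3
    funext i
    simpa using mul_inv_mul_cancel (d i)⁻¹
  · rw [hSd, key, tr]
  · rw [hSd, key, tr]

theorem exists_isPseudoinverse {ι : Type*} [Fintype ι] (M : Matrix ι ι ℝ) :
    ∃ X, IsPseudoinverse M X := by
  classical
  obtain ⟨Y, hY, hYs⟩ := exists_isPseudoinverse_of_symm (S := Mᵀ * M)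
    (by rw [Matrix.transpose_mul, Matrix.transpose_transpose])
  have hM : M * Y * (Mᵀ * M) = M := by
    have h0 : (M * Y * (Mᵀ * M) - M)ᵀ * (M * Y * (Mᵀ * M) - M) = 0 := by
      have e : Mᵀ * (M * Y * (Mᵀ * M) - M) = 0 := by
        rw [Matrix.mul_sub, sub_eq_zero]
        have := hY.mul_mul_left
        simpa only [Matrix.mul_assoc] using this
      have e2 : (M * Y * (Mᵀ * M) - M)ᵀ = (Mᵀ * M * Y - 1) * Mᵀ := by
        simp only [Matrix.transpose_sub, Matrix.transpose_mul, Matrix.transpose_transpose, hYs,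
          Matrix.sub_mul, Matrix.one_mul, Matrix.mul_assoc]
      rw [e2, Matrix.mul_assoc, e, Matrix.mul_zero]
    have h1 := Matrix.conjTranspose_mul_self_eq_zero.mp
      ((congrArg (· * (M * Y * (Mᵀ * M) - M))
        (Matrix.conjTranspose_eq_transpose_of_trivial _)).trans h0)
    exact sub_eq_zero.mp h1
  refine ⟨Y * Mᵀ, ⟨?_, ?_, ?_, ?_⟩⟩
  · simpa only [Matrix.mul_assoc] using hM
  · have := congrArg (· * Mᵀ) hY.mul_mul_right
    simpa only [Matrix.mul_assoc] using this
  · simp only [Matrix.transpose_mul, Matrix.transpose_transpose, hYs, Matrix.mul_assoc]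
  · have := hY.symm_right
    simpa only [Matrix.mul_assoc] using this

/-- The Moore–Penrose pseudoinverse of a real square matrix, i.e. the unique solution of the
Penrose equations. -/
def pinv {ι : Type*} [Fintype ι] (M : Matrix ι ι ℝ) : Matrix ι ι ℝ :=
  (exists_isPseudoinverse M).choose

theorem pinv_spec {ι : Type*} [Fintype ι] (M : Matrix ι ι ℝ) : IsPseudoinverse M (pinv M) :=
  (exists_isPseudoinverse M).choose_spec

/-! ### Realizability for the monomial basis on `[-1, 1]` -/

/-- The realizable set of order `N`: moment vectors `(∫ x ^ i dψ)` for `i = 0, …, N`, of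
nonnegative distributions `ψ` (finite Borel measures, so that Dirac deltas are allowed) on
`[-1, 1]` with positive total mass. -/
def realizableSet (N : ℕ) : Set (Fin (N + 1) → ℝ) :=
  {u | ∃ ψ : Measure (Set.Icc (-1 : ℝ) 1), IsFiniteMeasure ψ ∧ 0 < ψ Set.univ ∧
    ∀ i : Fin (N + 1), u i = ∫ x, (x : ℝ) ^ (i : ℕ) ∂ψ}

/-- The component `u_j` of a moment vector `u = (u_0, …, u_N)`; the value `0` for `j > N` is
never used below. -/
def mom {N : ℕ} (u : Fin (N + 1) → ℝ) (j : ℕ) : ℝ :=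
  if h : j < N + 1 then u ⟨j, h⟩ else 0

/-- The `n × n` Hankel matrix `(u_{i+j})` for `i, j = 0, …, n - 1`, that is `A(n-1)`
(the empty matrix for `n = 0`). -/
def hankelA {N : ℕ} (u : Fin (N + 1) → ℝ) (n : ℕ) : Matrix (Fin n) (Fin n) ℝ :=
  Matrix.of fun i j => mom u ((i : ℕ) + j)

/-- The `n × n` Hankel matrix `(u_{i+j+1})` for `i, j = 0, …, n - 1`, that is `B(n-1)`. -/
def hankelB {N : ℕ} (u : Fin (N + 1) → ℝ) (n : ℕ) : Matrix (Fin n) (Fin n) ℝ :=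
  Matrix.of fun i j => mom u ((i : ℕ) + j + 1)

/-- The `n × n` Hankel matrix `(u_{i+j})` for `i, j = 1, …, n`, that is `C(n)`. -/
def hankelC {N : ℕ} (u : Fin (N + 1) → ℝ) (n : ℕ) : Matrix (Fin n) (Fin n) ℝ :=
  Matrix.of fun i j => mom u (((i : ℕ) + 1) + ((j : ℕ) + 1))

/-- The Hankel positivity conditions on `u = (u_0, …, u_N)`.
If `N = 2k`: `A(k) ≥ 0` and `A(k-1) ≥ C(k)`. If `N = 2k+1`: `A(k) ≥ B(k)` and `A(k) ≥ -B(k)`. -/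
def HankelConditions {N : ℕ} (u : Fin (N + 1) → ℝ) : Prop :=
  if Even N then
    (hankelA u (N / 2 + 1)).PosSemidef ∧ (hankelA u (N / 2) - hankelC u (N / 2)).PosSemidef
  else
    (hankelA u (N / 2 + 1) - hankelB u (N / 2 + 1)).PosSemidef ∧
      (hankelA u (N / 2 + 1) - -hankelB u (N / 2 + 1)).PosSemidef

/-- The quadratic form `bᵀ M b`. -/
def quadForm {n : ℕ} (M : Matrix (Fin n) (Fin n) ℝ) (b : Fin n → ℝ) : ℝ :=
  b ⬝ᵥ (M *ᵥ b)

/-- The upper bound `f_up(u_0, …, u_N)`.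
For `N = 2k` it is `u_N - b₋ᵀ (A(k-1) - B(k-1))⁺ b₋`, where
`b₋ = (u_k - u_{k+1}, …, u_{N-1} - u_N)`.
For `N = 2k+1` it is `u_{N-1} - b₋ᵀ (A(k-1) - C(k))⁺ b₋`, where
`b₋ = (u_k - u_{k+2}, …, u_{N-2} - u_N)`. -/
def fUp {N : ℕ} (u : Fin (N + 1) → ℝ) : ℝ :=
  let k := N / 2
  if Even N then
    mom u N - quadForm (pinv (hankelA u k - hankelB u k))
      (fun i : Fin k => mom u (k + i) - mom u (k + i + 1))
  else
    mom u (N - 1) - quadForm (pinv (hankelA u k - hankelC u k))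
      (fun i : Fin k => mom u (k + i) - mom u (k + i + 2))

/-- The lower bound `f_low(u_0, …, u_N)`.
For `N = 2k` it is `-u_N + b₊ᵀ (A(k-1) + B(k-1))⁺ b₊`, where
`b₊ = (u_k + u_{k+1}, …, u_{N-1} + u_N)`.
For `N = 2k+1` it is `b₊ᵀ A(k)⁺ b₊`, where `b₊ = (u_{k+1}, …, u_N)`. -/
def fLow {N : ℕ} (u : Fin (N + 1) → ℝ) : ℝ :=
  let k := N / 2
  if Even N then
    -mom u N + quadForm (pinv (hankelA u k + hankelB u k))
      (fun i : Fin k => mom u (k + i) + mom u (k + i + 1))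
  else
    quadForm (pinv (hankelA u (k + 1))) (fun i : Fin (k + 1) => mom u (k + 1 + i))

/-- The moment vector `(u_0, …, u_N, c)`. -/
def extend {N : ℕ} (u : Fin (N + 1) → ℝ) (c : ℝ) : Fin (N + 1 + 1) → ℝ :=
  Fin.snoc (α := fun _ => ℝ) u c

end FullMoment

end

/-!
Let `L` be the linear functional on `ℝ[X]` with `L (X ^ i) = u_i`. The Hankel matrices `A`,
`A - B`, `A + B`, `A - C` are the Gram matrices of the forms `(p, q) ↦ L (w * p * q)` on polynomials
of bounded degree, for the weights `w = 1`, `1 - X`, `1 + X`, `1 - X ^ 2`, all nonnegative on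
`[-1, 1]`.

The Hankel conditions characterize realizability among vectors with `u_0 > 0`
(`mem_realizableSet_iff`). They are necessary since `L (w * q ^ 2)` is then the integral of a
nonnegative function. Conversely, the moment vectors of probability measures on `[-1, 1]` form a
convex set, which is closed because the space of these measures is weakly compact. A vector outside
of it, normalized to `u_0 = 1`, is strictly separated from it by a hyperplane, that is, by a
polynomial `p` of degree at most `N` that is positive on `[-1, 1]` and has `L p < 0`. The Hankel
conditions exclude this (`HankelConditions.map_nonneg_of_pos`): having no root in `[-1, 1]`, such a
`p` is, up to a positive constant, a product of factors `α (1 - X) + β (1 + X)` with `α, β ≥ 0` and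
`(X - s) ^ 2 + t ^ 2`; expanded, it is a nonnegative combination of terms
`(1 - X) ^ a * (1 + X) ^ b * q ^ 2` with `a + b + 2 * deg q ≤ N`. The identity
`2 = (1 - X) + (1 + X)` raises `a + b`, and the terms that result are those at which the Hankel
conditions make `L` nonnegative.

The bounds on the next moment are Schur complements (`hankelConditions_extend_iff`). Each of the two
Gram matrices for `(u_0, …, u_{N+1})` is bordered: its leading block and the rest of its last column
involve only `u_0, …, u_N`, and its corner contains `u_{N+1}`. If `u` is realized by `ψ`, the
leading block is positive semidefinite, and the last column is orthogonal to its kernel, because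
`∫ w p² dψ = 0` forces `w p = 0` almost everywhere. Therefore positive semidefiniteness of the whole
matrix is the single inequality that the Schur complement formed with the pseudoinverse is
nonnegative, also for a singular block.

A measure realizing `u` has a moment of order `N + 1`, which lies between the two bounds, so that
`f_low ≤ f_up`.
-/

open MeasureTheory Matrix

noncomputable section

namespace FullMoment

open Polynomial

/-! ### Moment functionals and Gram matrices -/

/-- The linear functional on `ℝ[X]` that takes the value `m i` at `X ^ i`. -/
def momentFunctional (m : ℕ → ℝ) : ℝ[X] →ₗ[ℝ] ℝ :=
  Polynomial.lsum fun i => LinearMap.mulRight ℝ (m i)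

theorem momentFunctional_apply (m : ℕ → ℝ) (p : ℝ[X]) :
    momentFunctional m p = p.sum fun i a => a * m i := rfl

@[simp]
theorem momentFunctional_X_pow (m : ℕ → ℝ) (i : ℕ) : momentFunctional m (X ^ i) = m i := by
  rw [momentFunctional_apply, ← monomial_one_right_eq_X_pow, sum_monomial_index _ _ (by simp),
    one_mul]

theorem momentFunctional_congr {m m' : ℕ → ℝ} {N : ℕ} (h : ∀ i ≤ N, m i = m' i) {p : ℝ[X]}
    (hp : p.natDegree ≤ N) : momentFunctional m p = momentFunctional m' p := by
  rw [momentFunctional_apply, momentFunctional_apply]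
  refine Finset.sum_congr rfl fun i hi => ?_
  dsimp only
  rw [h i ((le_natDegree_of_mem_supp i hi).trans hp)]

/-- The Gram matrix of `1, X, …, X ^ (n - 1)` for the bilinear form `(p, q) ↦ L (w * p * q)`. -/
def gram (L : ℝ[X] →ₗ[ℝ] ℝ) (w : ℝ[X]) (n : ℕ) : Matrix (Fin n) (Fin n) ℝ :=
  Matrix.of fun i j => L (w * X ^ ((i : ℕ) + j))

/-- The polynomial with coefficient vector `x`. -/
def vecPoly {n : ℕ} (x : Fin n → ℝ) : ℝ[X] := ∑ i, C (x i) * X ^ (i : ℕ)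

theorem natDegree_vecPoly {n : ℕ} (x : Fin n → ℝ) : (vecPoly x).natDegree ≤ n - 1 :=
  natDegree_sum_le_of_forall_le _ _ fun i _ =>
    (natDegree_C_mul_X_pow_le _ _).trans (Nat.le_sub_one_of_lt i.2)

theorem exists_vecPoly_eq {n : ℕ} {q : ℝ[X]} (hq : q.natDegree < n) :
    ∃ x : Fin n → ℝ, vecPoly x = q := by
  refine ⟨fun i => q.coeff i, ?_⟩
  rw [vecPoly, Fin.sum_univ_eq_sum_range (fun i => C (q.coeff i) * X ^ i) n,
    ← as_sum_range_C_mul_X_pow' q hq]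

theorem gram_mulVec (L : ℝ[X] →ₗ[ℝ] ℝ) (w : ℝ[X]) {n : ℕ} (x : Fin n → ℝ) (i : Fin n) :
    (gram L w n *ᵥ x) i = L (w * X ^ (i : ℕ) * vecPoly x) := by
  simp only [mulVec, dotProduct, gram, of_apply, vecPoly, Finset.mul_sum, map_sum]
  refine Finset.sum_congr rfl fun j _ => ?_
  rw [show w * X ^ (i : ℕ) * (C (x j) * X ^ (j : ℕ)) = x j • (w * X ^ ((i : ℕ) + j)) by
    rw [smul_eq_C_mul]; ring, map_smul, smul_eq_mul, mul_comm]

theorem dotProduct_map_vecPoly (L : ℝ[X] →ₗ[ℝ] ℝ) (p : ℝ[X]) {n : ℕ} (x : Fin n → ℝ) :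
    (x ⬝ᵥ fun i => L (p * X ^ (i : ℕ))) = L (p * vecPoly x) := by
  simp only [dotProduct, vecPoly, Finset.mul_sum, map_sum]
  refine Finset.sum_congr rfl fun j _ => ?_
  rw [show p * (C (x j) * X ^ (j : ℕ)) = x j • (p * X ^ (j : ℕ)) by
    rw [smul_eq_C_mul]; ring, map_smul, smul_eq_mul]

theorem dotProduct_gram_mulVec (L : ℝ[X] →ₗ[ℝ] ℝ) (w : ℝ[X]) {n : ℕ} (x : Fin n → ℝ) :
    x ⬝ᵥ gram L w n *ᵥ x = L (w * vecPoly x ^ 2) := by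
  rw [show gram L w n *ᵥ x = fun i : Fin n => L (w * vecPoly x * X ^ (i : ℕ)) from
    funext fun i => by rw [gram_mulVec]; congr 1; ring, dotProduct_map_vecPoly]
  congr 1; ring

theorem transpose_gram (L : ℝ[X] →ₗ[ℝ] ℝ) (w : ℝ[X]) (n : ℕ) : (gram L w n)ᵀ = gram L w n := by
  ext i j; simp [gram, add_comm]

theorem posSemidef_gram_iff_forall_vec (L : ℝ[X] →ₗ[ℝ] ℝ) (w : ℝ[X]) (n : ℕ) :
    (gram L w n).PosSemidef ↔ ∀ x : Fin n → ℝ, 0 ≤ L (w * vecPoly x ^ 2) := by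
  rw [posSemidef_iff_dotProduct_mulVec, IsHermitian, conjTranspose_eq_transpose_of_trivial]
  simp only [transpose_gram, star_trivial, dotProduct_gram_mulVec, true_and]

theorem posSemidef_gram_iff (L : ℝ[X] →ₗ[ℝ] ℝ) (w : ℝ[X]) (n : ℕ) :
    (gram L w n).PosSemidef ↔ ∀ q : ℝ[X], q.natDegree < n → 0 ≤ L (w * q ^ 2) := by
  rw [posSemidef_gram_iff_forall_vec]
  refine ⟨fun h q hq => ?_, fun h x => ?_⟩
  · obtain ⟨x, rfl⟩ := exists_vecPoly_eq hq
    exact h x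
  · rcases n with _ | n
    · simp [vecPoly]
    · exact h _ (Nat.lt_succ_of_le (natDegree_vecPoly x))

/-! ### The Schur complement with a pseudoinverse -/

/-- A vector orthogonal to the kernel of a symmetric matrix lies in its range, and the
pseudoinverse provides a preimage. -/
theorem mul_pinv_mulVec_of_orthogonal_ker {ι : Type*} [Fintype ι] {M : Matrix ι ι ℝ}
    (hM : Mᵀ = M) {b : ι → ℝ} (hb : ∀ x, M *ᵥ x = 0 → x ⬝ᵥ b = 0) :
    M *ᵥ (pinv M *ᵥ b) = b := by
  have hX := pinv_spec M
  -- as `M` and `M * pinv M` are symmetric, this is the transpose of `M * pinv M * M = M`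
  have hMM : M * (M * pinv M) = M := by
    have := congrArg transpose hX.mul_mul_left
    rwa [transpose_mul, hX.symm_left, hM] at this
  set y := b - M *ᵥ (pinv M *ᵥ b) with hy
  have hMy : M *ᵥ y = 0 := by
    rw [hy, mulVec_sub, mulVec_mulVec, mulVec_mulVec, Matrix.mul_assoc, hMM, sub_self]
  have hyy : y ⬝ᵥ y = 0 := by
    nth_rw 2 [hy]
    rw [dotProduct_sub, hb y hMy, dotProduct_mulVec, ← mulVec_transpose, hM, hMy]
    simp
  exact (sub_eq_zero.mp (dotProduct_self_eq_zero.mp hyy)).symm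

theorem vecPoly_snoc {n : ℕ} (x : Fin n → ℝ) (t : ℝ) :
    vecPoly (Fin.snoc (α := fun _ => ℝ) x t) = vecPoly x + C t * X ^ n := by
  simp [vecPoly, Fin.sum_univ_castSucc]

/-- A Gram matrix whose leading block is positive semidefinite, and whose last column is orthogonal
to the kernel of that block, is positive semidefinite exactly if its generalized Schur complement
is nonnegative. -/
theorem posSemidef_gram_succ_iff {L : ℝ[X] →ₗ[ℝ] ℝ} {w : ℝ[X]} {n : ℕ}
    (hM : (gram L w n).PosSemidef)
    (hker : ∀ x : Fin n → ℝ, gram L w n *ᵥ x = 0 → L (w * X ^ n * vecPoly x) = 0) :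
    (gram L w (n + 1)).PosSemidef ↔
      quadForm (pinv (gram L w n)) (fun i => L (w * X ^ n * X ^ (i : ℕ))) ≤
        L (w * X ^ (n + n)) := by
  set b : Fin n → ℝ := fun i => L (w * X ^ n * X ^ (i : ℕ)) with hb
  set M := gram L w n with hMdef
  set z := pinv M *ᵥ b with hz
  have hMz : M *ᵥ z = b := by
    refine mul_pinv_mulVec_of_orthogonal_ker (transpose_gram L w n) fun x hx => ?_
    rw [hb, dotProduct_map_vecPoly, hker x hx]
  -- completing the square: the form at `(x, t)` is the form of `M` at `x + t z` plus `t ^ 2` times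
  -- the Schur complement
  have key : ∀ (x : Fin n → ℝ) (t : ℝ),
      L (w * vecPoly (Fin.snoc (α := fun _ => ℝ) x t) ^ 2) =
        (x + t • z) ⬝ᵥ M *ᵥ (x + t • z) + t ^ 2 * (L (w * X ^ (n + n)) - b ⬝ᵥ z) := by
    intro x t
    have hzx : z ⬝ᵥ M *ᵥ x = x ⬝ᵥ b := by
      rw [dotProduct_mulVec, ← mulVec_transpose, hMdef, transpose_gram, ← hMdef, hMz,
        dotProduct_comm]
    have h1 : L (w * vecPoly (Fin.snoc (α := fun _ => ℝ) x t) ^ 2) =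
        x ⬝ᵥ M *ᵥ x + 2 * t * (x ⬝ᵥ b) + t ^ 2 * L (w * X ^ (n + n)) := by
      rw [vecPoly_snoc, hMdef, dotProduct_gram_mulVec, hb, dotProduct_map_vecPoly,
        show w * (vecPoly x + C t * X ^ n) ^ 2 = w * vecPoly x ^ 2 +
          (2 * t) • (w * X ^ n * vecPoly x) + t ^ 2 • (w * X ^ (n + n)) by
        simp only [smul_eq_C_mul, C_mul, C_pow, C_ofNat]; ring]
      simp only [map_add, map_smul, smul_eq_mul]
    rw [h1]
    simp only [mulVec_add, mulVec_smul, add_dotProduct, dotProduct_add, smul_dotProduct,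
      dotProduct_smul, smul_eq_mul, hMz, hzx, dotProduct_comm b z]
    ring
  have hquad : quadForm (pinv M) b = b ⬝ᵥ z := rfl
  rw [posSemidef_gram_iff_forall_vec, hquad]
  constructor
  · intro h
    have := h (Fin.snoc (α := fun _ => ℝ) (-z) 1)
    rw [key] at this
    simpa using this
  · intro h x
    rw [← Fin.snoc_init_self x, key]
    have := hM.dotProduct_mulVec_nonneg (Fin.init x + x (Fin.last n) • z)
    rw [star_trivial] at this
    exact add_nonneg this (mul_nonneg (sq_nonneg _) (sub_nonneg.mpr h))

/-! ### Functionals given by a measure -/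

theorem integrable_eval (ψ : Measure (Set.Icc (-1 : ℝ) 1)) [IsFiniteMeasure ψ] (p : ℝ[X]) :
    Integrable (fun x : Set.Icc (-1 : ℝ) 1 => p.eval (x : ℝ)) ψ :=
  (p.continuous.comp continuous_subtype_val).integrable_of_hasCompactSupport
    (HasCompactSupport.of_compactSpace _)

theorem momentFunctional_integral (ψ : Measure (Set.Icc (-1 : ℝ) 1)) [IsFiniteMeasure ψ]
    (p : ℝ[X]) :
    momentFunctional (fun i => ∫ x, (x : ℝ) ^ i ∂ψ) p = ∫ x, p.eval (x : ℝ) ∂ψ := by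
  induction p using Polynomial.induction_on' with
  | add p q hp hq =>
    simp only [map_add, eval_add, hp, hq]
    rw [integral_add (integrable_eval ψ p) (integrable_eval ψ q)]
  | monomial i a =>
    rw [← C_mul_X_pow_eq_monomial, ← smul_eq_C_mul, map_smul, momentFunctional_X_pow]
    simp [integral_const_mul]

theorem posSemidef_gram_of_integral {ψ : Measure (Set.Icc (-1 : ℝ) 1)}
    {L : ℝ[X] →ₗ[ℝ] ℝ} {N : ℕ}
    (hL : ∀ p : ℝ[X], p.natDegree ≤ N → L p = ∫ x, p.eval (x : ℝ) ∂ψ)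
    {w : ℝ[X]} (hw : ∀ x ∈ Set.Icc (-1 : ℝ) 1, 0 ≤ w.eval x) {n : ℕ}
    (hn : w.natDegree + 2 * n ≤ N + 2) : (gram L w n).PosSemidef := by
  rw [posSemidef_gram_iff]
  intro q hq
  rw [hL]
  · refine integral_nonneg fun x => ?_
    simp only [eval_mul, eval_pow]
    exact mul_nonneg (hw x x.2) (sq_nonneg _)
  · have h1 := natDegree_mul_le (p := w) (q := q ^ 2)
    have h2 := natDegree_pow_le (p := q) (n := 2)
    omega

/-- If `∫ w p² dψ = 0` then `w p` vanishes almost everywhere, so `∫ w Xⁿ p dψ = 0`. -/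
theorem map_mul_vecPoly_eq_zero_of_gram_mulVec_eq_zero
    {ψ : Measure (Set.Icc (-1 : ℝ) 1)} [IsFiniteMeasure ψ] {L : ℝ[X] →ₗ[ℝ] ℝ} {N : ℕ}
    (hL : ∀ p : ℝ[X], p.natDegree ≤ N → L p = ∫ x, p.eval (x : ℝ) ∂ψ)
    {w : ℝ[X]} (hw : ∀ x ∈ Set.Icc (-1 : ℝ) 1, 0 ≤ w.eval x) {n : ℕ}
    (hn : w.natDegree + 2 * n ≤ N + 1) (x : Fin n → ℝ) (hx : gram L w n *ᵥ x = 0) :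
    L (w * X ^ n * vecPoly x) = 0 := by
  rcases Nat.eq_zero_or_pos n with rfl | hn0
  · simp [vecPoly]
  have hp := natDegree_vecPoly x
  have h0 : L (w * vecPoly x ^ 2) = 0 := by rw [← dotProduct_gram_mulVec, hx, dotProduct_zero]
  have h1 := natDegree_mul_le (p := w) (q := vecPoly x ^ 2)
  have h2 := natDegree_pow_le (p := vecPoly x) (n := 2)
  have h3 := natDegree_mul_le (p := w * X ^ n) (q := vecPoly x)
  have h4 := natDegree_mul_le (p := w) (q := (X : ℝ[X]) ^ n)
  have h5 := natDegree_X_pow_le (R := ℝ) n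
  rw [hL _ (by omega), integral_eq_zero_iff_of_nonneg _ (integrable_eval ψ _)] at h0
  · rw [hL _ (by omega)]
    refine integral_eq_zero_of_ae ?_
    filter_upwards [h0] with y hy
    simp only [eval_mul, eval_pow, Pi.zero_apply, mul_eq_zero, pow_eq_zero_iff two_ne_zero] at hy ⊢
    tauto
  · intro y
    simp only [eval_mul, eval_pow, Pi.zero_apply]
    exact mul_nonneg (hw y y.2) (sq_nonneg _)

/-! ### Hankel conditions and positive polynomials on `[-1, 1]` -/

section Hankel

variable {N : ℕ} (u : Fin (N + 1) → ℝ) (n : ℕ)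

theorem hankelA_eq_gram : hankelA u n = gram (momentFunctional (mom u)) 1 n := by
  ext i j; simp [hankelA, gram]

theorem hankelA_sub_hankelB_eq_gram :
    hankelA u n - hankelB u n = gram (momentFunctional (mom u)) (1 - X) n := by
  ext i j
  simp [hankelA, hankelB, gram, sub_mul, ← pow_succ']

theorem hankelA_add_hankelB_eq_gram :
    hankelA u n + hankelB u n = gram (momentFunctional (mom u)) (1 + X) n := by
  ext i j
  simp [hankelA, hankelB, gram, add_mul, ← pow_succ']

theorem hankelA_sub_hankelC_eq_gram :
    hankelA u n - hankelC u n = gram (momentFunctional (mom u)) (1 - X ^ 2) n := by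
  ext i j
  simp only [hankelA, hankelC, gram, sub_mul, ← pow_add, one_mul, Matrix.sub_apply, of_apply,
    map_sub, momentFunctional_X_pow]
  congr 2; ring

end Hankel

theorem hankelConditions_two_mul_iff {k : ℕ} (u : Fin (2 * k + 1) → ℝ) :
    HankelConditions u ↔ (gram (momentFunctional (mom u)) 1 (k + 1)).PosSemidef ∧
      (gram (momentFunctional (mom u)) (1 - X ^ 2) k).PosSemidef := by
  rw [HankelConditions, if_pos (even_two_mul k), hankelA_sub_hankelC_eq_gram, hankelA_eq_gram,
    Nat.mul_div_cancel_left k two_pos]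

theorem hankelConditions_two_mul_add_one_iff {k : ℕ} (u : Fin (2 * k + 1 + 1) → ℝ) :
    HankelConditions u ↔ (gram (momentFunctional (mom u)) (1 - X) (k + 1)).PosSemidef ∧
      (gram (momentFunctional (mom u)) (1 + X) (k + 1)).PosSemidef := by
  rw [HankelConditions, if_neg (by simp), sub_neg_eq_add, hankelA_sub_hankelB_eq_gram,
    hankelA_add_hankelB_eq_gram, show (2 * k + 1) / 2 = k by omega]

theorem natDegree_one_sub_X_le : (1 - X : ℝ[X]).natDegree ≤ 1 := by compute_degree

theorem natDegree_one_add_X_le : (1 + X : ℝ[X]).natDegree ≤ 1 := by compute_degree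

theorem natDegree_weight_mul_le (a b : ℕ) (q : ℝ[X]) :
    ((1 - X) ^ a * (1 + X) ^ b * q : ℝ[X]).natDegree ≤ a + b + q.natDegree := by
  refine natDegree_mul_le.trans (Nat.add_le_add_right (natDegree_mul_le.trans ?_) _)
  exact Nat.add_le_add (by simpa using natDegree_pow_le_of_le a natDegree_one_sub_X_le)
    (by simpa using natDegree_pow_le_of_le b natDegree_one_add_X_le)

/-- The Hankel conditions make the moment functional nonnegative at
`(1 - X) ^ a * (1 + X) ^ b * q ^ 2` whenever `a + b + 2 * e = N` and `deg q ≤ e`: even powers of the weights are absorbed into the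
square, which leaves the four weights `1`, `1 - X`, `1 + X`, `1 - X ^ 2`. -/
theorem HankelConditions.map_weight_mul_sq_nonneg_of_eq {N : ℕ} {u : Fin (N + 1) → ℝ}
    (h : HankelConditions u) {a b e : ℕ} {q : ℝ[X]} (hq : q.natDegree ≤ e)
    (hN : a + b + 2 * e = N) :
    0 ≤ momentFunctional (mom u) ((1 - X) ^ a * (1 + X) ^ b * q ^ 2) := by
  have hdeg := natDegree_weight_mul_le (a / 2) (b / 2) q
  set r := (1 - X) ^ (a / 2) * (1 + X) ^ (b / 2) * q with hr
  have hprod : (1 - X) ^ a * (1 + X) ^ b * q ^ 2 =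
      (1 - X) ^ (a % 2) * (1 + X) ^ (b % 2) * r ^ 2 := by
    nth_rw 1 [← Nat.mod_add_div a 2, ← Nat.mod_add_div b 2]
    rw [hr]; ring
  rw [hprod]
  obtain ⟨k, rfl | rfl⟩ := Nat.even_or_odd' N
  · rw [hankelConditions_two_mul_iff, posSemidef_gram_iff, posSemidef_gram_iff] at h
    rcases Nat.mod_two_eq_zero_or_one a with ha | ha
    · have hb : b % 2 = 0 := by omega
      simpa [ha, hb] using h.1 r (by omega)
    · have hb : b % 2 = 1 := by omega
      rw [ha, hb, show (1 - X : ℝ[X]) ^ 1 * (1 + X) ^ 1 = 1 - X ^ 2 by ring]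
      exact h.2 r (by omega)
  · rw [hankelConditions_two_mul_add_one_iff, posSemidef_gram_iff, posSemidef_gram_iff] at h
    rcases Nat.mod_two_eq_zero_or_one a with ha | ha
    · have hb : b % 2 = 1 := by omega
      simpa [ha, hb] using h.2 r (by omega)
    · have hb : b % 2 = 0 := by omega
      simpa [ha, hb] using h.1 r (by omega)

theorem HankelConditions.map_weight_mul_sq_nonneg {N : ℕ} {u : Fin (N + 1) → ℝ}
    (h : HankelConditions u) {a b e : ℕ} {q : ℝ[X]} (hq : q.natDegree ≤ e)
    (hN : a + b + 2 * e ≤ N) :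
    0 ≤ momentFunctional (mom u) ((1 - X) ^ a * (1 + X) ^ b * q ^ 2) := by
  obtain ⟨s, hs⟩ := Nat.exists_eq_add_of_le hN
  induction s generalizing a b with
  | zero => exact h.map_weight_mul_sq_nonneg_of_eq hq (by omega)
  | succ s ih =>
    -- `2 = (1 - X) + (1 + X)` raises the degree by one
    have h1 := ih (a := a + 1) (b := b) (by omega) (by omega)
    have h2 := ih (a := a) (b := b + 1) (by omega) (by omega)
    have h3 : (2 : ℝ) • ((1 - X) ^ a * (1 + X) ^ b * q ^ 2 : ℝ[X]) =
        (1 - X) ^ (a + 1) * (1 + X) ^ b * q ^ 2 + (1 - X) ^ a * (1 + X) ^ (b + 1) * q ^ 2 := by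
      rw [smul_eq_C_mul, C_ofNat]; ring
    have h4 := congrArg (momentFunctional (mom u)) h3
    rw [map_smul, map_add, smul_eq_mul] at h4
    linarith

/-- A nonconstant polynomial that is positive on `[-1, 1]` splits off a nonnegative combination of
`1 - X` and `1 + X`, coming from a real root outside `[-1, 1]`, or a sum of two squares, coming from
a pair of complex conjugate roots. -/
theorem exists_factor_of_pos {p : ℝ[X]} (hp : ∀ x ∈ Set.Icc (-1 : ℝ) 1, 0 < p.eval x)
    (hd : p.natDegree ≠ 0) :
    ∃ r : ℝ[X], (∀ x ∈ Set.Icc (-1 : ℝ) 1, 0 < r.eval x) ∧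
      ((r.natDegree + 1 = p.natDegree ∧ ∃ α β : ℝ, 0 ≤ α ∧ 0 ≤ β ∧
          p = r * (C α * (1 - X) + C β * (1 + X))) ∨
        (r.natDegree + 2 = p.natDegree ∧ ∃ s t : ℝ, p = r * ((X - C s) ^ 2 + C (t ^ 2)))) := by
  have hp0 : p ≠ 0 := by rintro rfl; simp at hd
  obtain ⟨z, hz⟩ := IsAlgClosed.exists_aeval_eq_zero ℂ p
    (fun h => hd (natDegree_eq_of_degree_eq_some h))
  by_cases him : z.im = 0
  · have hroot : p.IsRoot z.re := by
      have hzre : z = algebraMap ℝ ℂ z.re := by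
        apply Complex.ext <;> simp [him]
      rw [hzre, aeval_algebraMap_apply] at hz
      simpa [aeval_def, IsRoot] using hz
    have hnot : ¬ (-1 ≤ z.re ∧ z.re ≤ 1) := fun h => (hp _ h).ne' hroot
    obtain ⟨r, hr⟩ := dvd_iff_isRoot.mpr hroot
    have hr0 : r ≠ 0 := by rintro rfl; simp [hr] at hp0
    have hdeg : p.natDegree = 1 + r.natDegree := by
      rw [hr, natDegree_mul (X_sub_C_ne_zero _) hr0, natDegree_X_sub_C]
    rcases lt_or_ge 1 z.re with h1 | h1
    · refine ⟨-r, fun x hx => ?_, Or.inl ⟨by rw [natDegree_neg]; omega,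
        (z.re + 1) / 2, (z.re - 1) / 2, by linarith, by linarith, ?_⟩⟩
      · have := hp x hx
        rw [hr] at this
        simp only [eval_mul, eval_sub, eval_X, eval_C, eval_neg] at this ⊢
        have hx2 := hx.2
        by_contra hc
        nlinarith
      · have e1 : C ((z.re + 1) / 2) + C ((z.re - 1) / 2) = C z.re := by rw [← C_add]; congr 1; ring
        have e2 : C ((z.re + 1) / 2) - C ((z.re - 1) / 2) = (1 : ℝ[X]) := by
          rw [← C_sub, ← C_1]; congr 1; ring
        linear_combination hr + r * e1 - r * X * e2
    · have h2 : z.re < -1 := by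
        by_contra hc
        exact hnot ⟨not_lt.mp hc, h1⟩
      refine ⟨r, fun x hx => ?_, Or.inl ⟨by omega,
        (-z.re - 1) / 2, (-z.re + 1) / 2, by linarith, by linarith, ?_⟩⟩
      · have := hp x hx
        rw [hr] at this
        simp only [eval_mul, eval_sub, eval_X, eval_C] at this ⊢
        have hx1 := hx.1
        by_contra hc
        nlinarith
      · have e1 : C ((-z.re - 1) / 2) + C ((-z.re + 1) / 2) = -C z.re := by
          rw [← C_add, ← C_neg]; congr 1; ring
        have e2 : C ((-z.re + 1) / 2) - C ((-z.re - 1) / 2) = (1 : ℝ[X]) := by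
          rw [← C_sub, ← C_1]; congr 1; ring
        linear_combination hr - r * e1 - r * X * e2
  · obtain ⟨r, hr⟩ := p.quadratic_dvd_of_aeval_eq_zero_im_ne_zero hz him
    have hquad : X ^ 2 - C (2 * z.re) * X + C (‖z‖ ^ 2) = (X - C z.re) ^ 2 + C (z.im ^ 2) := by
      rw [← Complex.normSq_eq_norm_sq, Complex.normSq_apply]
      simp only [C_add, C_mul, C_pow, C_ofNat]; ring
    rw [hquad] at hr
    have hr0 : r ≠ 0 := by rintro rfl; simp [hr] at hp0
    have hdeg : p.natDegree = 2 + r.natDegree := by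
      have h2 : ((X - C z.re) ^ 2 + C (z.im ^ 2)).natDegree = 2 := by
        rw [natDegree_add_C, natDegree_pow, natDegree_X_sub_C]
      have h3 : (X - C z.re) ^ 2 + C (z.im ^ 2) ≠ 0 := by
        intro h; rw [h, natDegree_zero] at h2; omega
      rw [hr, natDegree_mul h3 hr0, h2]
    refine ⟨r, fun x hx => ?_, Or.inr ⟨by omega, z.re, z.im, by rw [mul_comm]; exact hr⟩⟩
    have := hp x hx
    rw [hr] at this
    simp only [eval_mul, eval_add, eval_pow, eval_sub, eval_X, eval_C] at this
    exact pos_of_mul_pos_right this (by positivity)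

/-- Under the Hankel conditions the moment functional is nonnegative at the product of a
polynomial `p` positive on `[-1, 1]` with a weighted square, if the degrees add up to at most `N`.
The induction on the degree of `p` peels off its factors and moves them into the weights and the
square. -/
theorem HankelConditions.map_mul_weight_nonneg {N : ℕ} {u : Fin (N + 1) → ℝ}
    (h : HankelConditions u) {p : ℝ[X]} (hp : ∀ x ∈ Set.Icc (-1 : ℝ) 1, 0 < p.eval x)
    {a b e : ℕ} {q : ℝ[X]} (hq : q.natDegree ≤ e) (hN : a + b + 2 * e + p.natDegree ≤ N) :
    0 ≤ momentFunctional (mom u) (p * ((1 - X) ^ a * (1 + X) ^ b * q ^ 2)) := by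
  induction hd : p.natDegree using Nat.strong_induction_on generalizing p a b e q with
  | _ d ih =>
    by_cases hd0 : p.natDegree = 0
    · obtain ⟨c, rfl⟩ := natDegree_eq_zero.mp hd0
      rw [← smul_eq_C_mul, map_smul, smul_eq_mul]
      refine mul_nonneg ?_ (h.map_weight_mul_sq_nonneg hq (by omega))
      simpa using (hp 0 (by norm_num)).le
    obtain ⟨r, hr, ⟨hdeg, α, β, hα, hβ, hpr⟩ | ⟨hdeg, s, t, hpr⟩⟩ := exists_factor_of_pos hp hd0
    · have h1 := ih r.natDegree (by omega) hr (a := a + 1) (b := b) hq (by omega) rfl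
      have h2 := ih r.natDegree (by omega) hr (a := a) (b := b + 1) hq (by omega) rfl
      rw [hpr, show r * (C α * (1 - X) + C β * (1 + X)) * ((1 - X) ^ a * (1 + X) ^ b * q ^ 2) =
          α • (r * ((1 - X) ^ (a + 1) * (1 + X) ^ b * q ^ 2)) +
          β • (r * ((1 - X) ^ a * (1 + X) ^ (b + 1) * q ^ 2)) by
        simp only [smul_eq_C_mul]; ring, map_add, map_smul, map_smul]
      exact add_nonneg (mul_nonneg hα h1) (mul_nonneg hβ h2)
    · have hq' : ((X - C s) * q).natDegree ≤ e + 1 := by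
        refine natDegree_mul_le.trans ?_
        rw [natDegree_X_sub_C]; omega
      have h1 := ih r.natDegree (by omega) hr (a := a) (b := b) hq' (by omega) rfl
      have h2 := ih r.natDegree (by omega) hr (a := a) (b := b) hq (by omega) rfl
      rw [hpr, show r * ((X - C s) ^ 2 + C (t ^ 2)) * ((1 - X) ^ a * (1 + X) ^ b * q ^ 2) =
          r * ((1 - X) ^ a * (1 + X) ^ b * ((X - C s) * q) ^ 2) +
          t ^ 2 • (r * ((1 - X) ^ a * (1 + X) ^ b * q ^ 2)) by
        simp only [smul_eq_C_mul]; ring, map_add, map_smul]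
      exact add_nonneg h1 (mul_nonneg (sq_nonneg t) h2)

theorem HankelConditions.map_nonneg_of_pos {N : ℕ} {u : Fin (N + 1) → ℝ}
    (h : HankelConditions u) {p : ℝ[X]} (hp : ∀ x ∈ Set.Icc (-1 : ℝ) 1, 0 < p.eval x)
    (hN : p.natDegree ≤ N) : 0 ≤ momentFunctional (mom u) p := by
  simpa using h.map_mul_weight_nonneg hp (a := 0) (b := 0) (e := 0) (q := 1) (by simp) (by omega)

/-! ### The truncated moment problem on `[-1, 1]` -/

/-- The moment vector of order `N` of a measure on `[-1, 1]`. -/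
def momentVec (N : ℕ) (ψ : Measure (Set.Icc (-1 : ℝ) 1)) : Fin (N + 1) → ℝ :=
  fun i => ∫ x, (x : ℝ) ^ (i : ℕ) ∂ψ

theorem integrable_pow (ψ : Measure (Set.Icc (-1 : ℝ) 1)) [IsFiniteMeasure ψ] (i : ℕ) :
    Integrable (fun x : Set.Icc (-1 : ℝ) 1 => (x : ℝ) ^ i) ψ := by
  simpa using integrable_eval ψ (X ^ i)

theorem momentVec_add (N : ℕ) (ψ φ : Measure (Set.Icc (-1 : ℝ) 1)) [IsFiniteMeasure ψ]
    [IsFiniteMeasure φ] : momentVec N (ψ + φ) = momentVec N ψ + momentVec N φ := by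
  funext i
  exact integral_add_measure (integrable_pow ψ i) (integrable_pow φ i)

theorem momentVec_smul (N : ℕ) (ψ : Measure (Set.Icc (-1 : ℝ) 1)) {c : ℝ} (hc : 0 ≤ c) :
    momentVec N (ENNReal.ofReal c • ψ) = c • momentVec N ψ := by
  funext i
  simp [momentVec, integral_smul_measure, ENNReal.toReal_ofReal hc]

/-- The set of moment vectors of probability measures on `[-1, 1]`. -/
def normalizedMoments (N : ℕ) : Set (Fin (N + 1) → ℝ) :=
  Set.range fun ψ : ProbabilityMeasure (Set.Icc (-1 : ℝ) 1) => momentVec N ψ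

/-- The space of probability measures on a compact space is weakly compact. -/
theorem isClosed_normalizedMoments (N : ℕ) : IsClosed (normalizedMoments N) := by
  refine (isCompact_range ?_).isClosed
  refine continuous_pi fun i => ?_
  exact ProbabilityMeasure.continuous_integral_continuousMap
    (⟨fun x : Set.Icc (-1 : ℝ) 1 => (x : ℝ) ^ (i : ℕ), by fun_prop⟩ : C(Set.Icc (-1 : ℝ) 1, ℝ))

theorem convex_normalizedMoments (N : ℕ) : Convex ℝ (normalizedMoments N) := by
  rintro _ ⟨ψ, rfl⟩ _ ⟨φ, rfl⟩ a b ha hb hab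
  refine ⟨⟨ENNReal.ofReal a • (ψ : Measure (Set.Icc (-1 : ℝ) 1)) +
    ENNReal.ofReal b • (φ : Measure (Set.Icc (-1 : ℝ) 1)), ⟨?_⟩⟩, ?_⟩
  · simp [← ENNReal.ofReal_add ha hb, hab]
  · have h1 : IsFiniteMeasure (ENNReal.ofReal a • (ψ : Measure (Set.Icc (-1 : ℝ) 1))) :=
      Measure.smul_finite _ ENNReal.ofReal_ne_top
    have h2 : IsFiniteMeasure (ENNReal.ofReal b • (φ : Measure (Set.Icc (-1 : ℝ) 1))) :=
      Measure.smul_finite _ ENNReal.ofReal_ne_top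
    simp only [ProbabilityMeasure.coe_mk]
    rw [momentVec_add, momentVec_smul _ _ ha, momentVec_smul _ _ hb]

theorem mom_val {N : ℕ} (u : Fin (N + 1) → ℝ) (i : Fin (N + 1)) : mom u i = u i := by
  simp only [mom, i.2, dif_pos]

/-- If every polynomial that is positive on `[-1, 1]` has nonnegative image under the moment
functional, then no hyperplane separates the normalized moment vector from the compact convex set of
moment vectors of probability measures. -/
theorem mem_realizableSet_of_forall_pos {N : ℕ} {u : Fin (N + 1) → ℝ} (hu : 0 < u 0)
    (h : ∀ p : ℝ[X], (∀ x ∈ Set.Icc (-1 : ℝ) 1, 0 < p.eval x) → p.natDegree ≤ N →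
      0 ≤ momentFunctional (mom u) p) : u ∈ realizableSet N := by
  have hmem : (u 0)⁻¹ • u ∈ normalizedMoments N := by
    by_contra hnot
    obtain ⟨f, s, hfs, hsf⟩ := geometric_hahn_banach_point_closed (convex_normalizedMoments N)
      (isClosed_normalizedMoments N) hnot
    have hf : ∀ v : Fin (N + 1) → ℝ, f v = ∑ i, f (Pi.single i 1) * v i := by
      intro v
      conv_lhs => rw [pi_eq_sum_univ' v]
      simp only [map_sum, map_smul, smul_eq_mul]
      exact Finset.sum_congr rfl fun i _ => by rw [mul_comm]
    set p : ℝ[X] := vecPoly (fun i : Fin (N + 1) => f (Pi.single i 1)) - C s with hp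
    have hpos : ∀ x ∈ Set.Icc (-1 : ℝ) 1, 0 < p.eval x := by
      intro x hx
      have := hsf _ ⟨⟨Measure.dirac ⟨x, hx⟩, inferInstance⟩, rfl⟩
      rw [hf] at this
      simp only [ProbabilityMeasure.coe_mk, momentVec, integral_dirac] at this
      simp only [hp, vecPoly, eval_sub, eval_finsetSum, eval_mul, eval_C, eval_pow, eval_X]
      linarith
    have hdeg : p.natDegree ≤ N := by
      rw [hp, natDegree_sub_C]
      exact natDegree_vecPoly _
    have hval : momentFunctional (mom u) p = f u - s * u 0 := by
      have h0 : momentFunctional (mom u) (C s) = s * u 0 := by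
        rw [← mul_one (C s), ← pow_zero X, ← smul_eq_C_mul, map_smul, momentFunctional_X_pow]
        exact congrArg (s * ·) (mom_val u 0)
      rw [hp, map_sub, h0, hf u]
      simp only [vecPoly, map_sum, ← smul_eq_C_mul, map_smul, momentFunctional_X_pow, mom_val,
        smul_eq_mul]
    have h1 := h p hpos hdeg
    rw [hval] at h1
    rw [map_smul, smul_eq_mul, inv_mul_lt_iff₀ hu] at hfs
    linarith
  obtain ⟨ψ, hψ⟩ := hmem
  refine ⟨ENNReal.ofReal (u 0) • (ψ : Measure (Set.Icc (-1 : ℝ) 1)),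
    Measure.smul_finite _ ENNReal.ofReal_ne_top, by simpa using hu, fun i => ?_⟩
  have h1 := congrFun (momentVec_smul N (ψ : Measure (Set.Icc (-1 : ℝ) 1)) hu.le) i
  have h2 : momentVec N (ψ : Measure (Set.Icc (-1 : ℝ) 1)) = (u 0)⁻¹ • u := hψ
  rw [h2, smul_inv_smul₀ hu.ne'] at h1
  exact h1.symm

theorem momentFunctional_eq_integral {N : ℕ} {u : Fin (N + 1) → ℝ}
    {ψ : Measure (Set.Icc (-1 : ℝ) 1)} [IsFiniteMeasure ψ] {n : ℕ}
    (hψ : ∀ i ≤ n, mom u i = ∫ x, (x : ℝ) ^ i ∂ψ) {p : ℝ[X]} (hp : p.natDegree ≤ n) :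
    momentFunctional (mom u) p = ∫ x, p.eval (x : ℝ) ∂ψ := by
  rw [momentFunctional_congr hψ hp, momentFunctional_integral]

theorem zero_lt_of_mem_realizableSet {N : ℕ} {u : Fin (N + 1) → ℝ} (hu : u ∈ realizableSet N) :
    0 < u 0 := by
  obtain ⟨ψ, hfin, hψ, h⟩ := hu
  rw [h 0]
  simpa [measureReal_def] using ENNReal.toReal_pos hψ.ne' (measure_ne_top ψ _)

theorem one_sub_X_nonneg (x : ℝ) (hx : x ∈ Set.Icc (-1 : ℝ) 1) : 0 ≤ (1 - X : ℝ[X]).eval x := by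
  simpa using hx.2

theorem one_add_X_nonneg (x : ℝ) (hx : x ∈ Set.Icc (-1 : ℝ) 1) : 0 ≤ (1 + X : ℝ[X]).eval x := by
  simp only [eval_add, eval_one, eval_X]; linarith [hx.1]

theorem one_sub_X_sq_nonneg (x : ℝ) (hx : x ∈ Set.Icc (-1 : ℝ) 1) :
    0 ≤ (1 - X ^ 2 : ℝ[X]).eval x := by
  simp only [eval_sub, eval_one, eval_X, eval_pow]; nlinarith [hx.1, hx.2]

theorem natDegree_one_sub_X_sq_le : (1 - X ^ 2 : ℝ[X]).natDegree ≤ 2 := by compute_degree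

theorem hankelConditions_of_mem_realizableSet {N : ℕ} {u : Fin (N + 1) → ℝ}
    (hu : u ∈ realizableSet N) : HankelConditions u := by
  obtain ⟨ψ, hfin, -, hψ⟩ := hu
  have hL : ∀ p : ℝ[X], p.natDegree ≤ N →
      momentFunctional (mom u) p = ∫ x, p.eval (x : ℝ) ∂ψ := fun p hp =>
    momentFunctional_eq_integral (fun i hi => by
      simpa [mom, Nat.lt_succ_of_le hi] using hψ ⟨i, Nat.lt_succ_of_le hi⟩) hp
  have d1 := natDegree_one_sub_X_le
  have d2 := natDegree_one_add_X_le
  have d3 := natDegree_one_sub_X_sq_le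
  obtain ⟨k, rfl | rfl⟩ := Nat.even_or_odd' N
  · rw [hankelConditions_two_mul_iff]
    exact ⟨posSemidef_gram_of_integral hL (by simp) (by rw [natDegree_one]; omega),
      posSemidef_gram_of_integral hL one_sub_X_sq_nonneg (by omega)⟩
  · rw [hankelConditions_two_mul_add_one_iff]
    exact ⟨posSemidef_gram_of_integral hL one_sub_X_nonneg (by omega),
      posSemidef_gram_of_integral hL one_add_X_nonneg (by omega)⟩

theorem mem_realizableSet_iff {N : ℕ} {u : Fin (N + 1) → ℝ} (hu : 0 < u 0) :
    u ∈ realizableSet N ↔ HankelConditions u :=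
  ⟨hankelConditions_of_mem_realizableSet, fun h =>
    mem_realizableSet_of_forall_pos hu fun _ hp hN => h.map_nonneg_of_pos hp hN⟩

/-! ### The bounds for the next moment -/

theorem mom_extend_of_le {N : ℕ} (u : Fin (N + 1) → ℝ) (c : ℝ) {i : ℕ} (hi : i ≤ N) :
    mom (extend u c) i = mom u i := by
  have h : i < N + 1 := Nat.lt_succ_of_le hi
  have h1 : (⟨i, h.trans (Nat.lt_succ_self _)⟩ : Fin (N + 1 + 1)) = Fin.castSucc ⟨i, h⟩ := rfl
  simp only [mom, h, h.trans (Nat.lt_succ_self _), dif_pos, extend]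
  rw [h1, Fin.snoc_castSucc]

theorem mom_extend_last {N : ℕ} (u : Fin (N + 1) → ℝ) (c : ℝ) :
    mom (extend u c) (N + 1) = c := by
  have h1 : (⟨N + 1, Nat.lt_succ_self _⟩ : Fin (N + 1 + 1)) = Fin.last (N + 1) := rfl
  simp only [mom, Nat.lt_succ_self, dif_pos, extend]
  rw [h1, Fin.snoc_last]

theorem gram_congr {L L' : ℝ[X] →ₗ[ℝ] ℝ} {w : ℝ[X]} {n N : ℕ}
    (h : ∀ p : ℝ[X], p.natDegree ≤ N → L p = L' p) (hn : w.natDegree + 2 * n ≤ N + 2) :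
    gram L w n = gram L' w n := by
  ext i j
  refine h _ (natDegree_mul_le.trans ?_)
  have := natDegree_X_pow_le (R := ℝ) ((i : ℕ) + j)
  omega

theorem fUp_two_mul {k : ℕ} (u : Fin (2 * k + 1) → ℝ) :
    fUp u = mom u (2 * k) - quadForm (pinv (gram (momentFunctional (mom u)) (1 - X) k))
      (fun i : Fin k => mom u (k + i) - mom u (k + i + 1)) := by
  rw [fUp, if_pos (even_two_mul k), show 2 * k / 2 = k by omega, hankelA_sub_hankelB_eq_gram]

theorem fLow_two_mul {k : ℕ} (u : Fin (2 * k + 1) → ℝ) :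
    fLow u = -mom u (2 * k) + quadForm (pinv (gram (momentFunctional (mom u)) (1 + X) k))
      (fun i : Fin k => mom u (k + i) + mom u (k + i + 1)) := by
  rw [fLow, if_pos (even_two_mul k), show 2 * k / 2 = k by omega, hankelA_add_hankelB_eq_gram]

theorem fUp_two_mul_add_one {k : ℕ} (u : Fin (2 * k + 1 + 1) → ℝ) :
    fUp u = mom u (2 * k) - quadForm (pinv (gram (momentFunctional (mom u)) (1 - X ^ 2) k))
      (fun i : Fin k => mom u (k + i) - mom u (k + i + 2)) := by
  rw [fUp, if_neg (by simp), show (2 * k + 1) / 2 = k by omega, hankelA_sub_hankelC_eq_gram,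
    Nat.add_sub_cancel]

theorem fLow_two_mul_add_one {k : ℕ} (u : Fin (2 * k + 1 + 1) → ℝ) :
    fLow u = quadForm (pinv (gram (momentFunctional (mom u)) 1 (k + 1)))
      (fun i : Fin (k + 1) => mom u (k + 1 + i)) := by
  rw [fLow, if_neg (by simp), show (2 * k + 1) / 2 = k by omega, hankelA_eq_gram]

/-- The Hankel conditions on the extended vector concern two Gram matrices whose leading blocks
involve only realizable moments; their Schur complements are the two bounds on the last moment. -/
theorem hankelConditions_extend_iff {N : ℕ} {u : Fin (N + 1) → ℝ} (hu : u ∈ realizableSet N)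
    (c : ℝ) : HankelConditions (extend u c) ↔ fUp u ≥ c ∧ c ≥ fLow u := by
  obtain ⟨ψ, hfin, -, hψ⟩ := hu
  have hm : ∀ i ≤ N, mom (extend u c) i = mom u i := fun i hi => mom_extend_of_le u c hi
  have hc : mom (extend u c) (N + 1) = c := mom_extend_last u c
  set L := momentFunctional (mom (extend u c)) with hLdef
  have hLL : ∀ p : ℝ[X], p.natDegree ≤ N → L p = momentFunctional (mom u) p := fun p hp =>
    momentFunctional_congr hm hp
  have hL : ∀ p : ℝ[X], p.natDegree ≤ N → L p = ∫ x, p.eval (x : ℝ) ∂ψ := fun p hp =>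
    momentFunctional_eq_integral (fun i hi => by
      rw [hm i hi]
      simpa [mom, Nat.lt_succ_of_le hi] using hψ ⟨i, Nat.lt_succ_of_le hi⟩) hp
  have d1 := natDegree_one_sub_X_le
  have d2 := natDegree_one_add_X_le
  have d3 := natDegree_one_sub_X_sq_le
  have d0 := natDegree_one (R := ℝ)
  have schur : ∀ {w : ℝ[X]} {n : ℕ}, (∀ x ∈ Set.Icc (-1 : ℝ) 1, 0 ≤ w.eval x) →
      w.natDegree + 2 * n ≤ N + 1 → ((gram L w (n + 1)).PosSemidef ↔
        quadForm (pinv (gram (momentFunctional (mom u)) w n))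
          (fun i => L (w * X ^ n * X ^ (i : ℕ))) ≤ L (w * X ^ (n + n))) := by
    intro w n hw hn
    rw [← gram_congr hLL (by omega)]
    exact posSemidef_gram_succ_iff (posSemidef_gram_of_integral hL hw (by omega))
      (map_mul_vecPoly_eq_zero_of_gram_mulVec_eq_zero hL hw hn)
  obtain ⟨k, rfl | rfl⟩ := Nat.even_or_odd' N
  · rw [hankelConditions_two_mul_add_one_iff, ← hLdef, schur one_sub_X_nonneg (by omega),
      schur one_add_X_nonneg (by omega), fUp_two_mul, fLow_two_mul]
    have e1 : ∀ i : Fin k, L ((1 - X) * X ^ k * X ^ (i : ℕ)) =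
        mom u (k + i) - mom u (k + i + 1) := by
      intro i
      rw [show ((1 - X) * X ^ k * X ^ (i : ℕ) : ℝ[X]) = X ^ (k + i : ℕ) - X ^ (k + i + 1 : ℕ) by
        ring, map_sub, hLdef, momentFunctional_X_pow, momentFunctional_X_pow, hm _ (by omega),
        hm _ (by omega)]
    have e2 : ∀ i : Fin k, L ((1 + X) * X ^ k * X ^ (i : ℕ)) =
        mom u (k + i) + mom u (k + i + 1) := by
      intro i
      rw [show ((1 + X) * X ^ k * X ^ (i : ℕ) : ℝ[X]) = X ^ (k + i : ℕ) + X ^ (k + i + 1 : ℕ) by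
        ring, map_add, hLdef, momentFunctional_X_pow, momentFunctional_X_pow, hm _ (by omega),
        hm _ (by omega)]
    have e3 : L ((1 - X) * X ^ (k + k)) = mom u (2 * k) - c := by
      rw [show ((1 - X) * X ^ (k + k) : ℝ[X]) = X ^ (2 * k) - X ^ (2 * k + 1) by ring,
        map_sub, hLdef, momentFunctional_X_pow, momentFunctional_X_pow, hm _ le_rfl, hc]
    have e4 : L ((1 + X) * X ^ (k + k)) = mom u (2 * k) + c := by
      rw [show ((1 + X) * X ^ (k + k) : ℝ[X]) = X ^ (2 * k) + X ^ (2 * k + 1) by ring,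
        map_add, hLdef, momentFunctional_X_pow, momentFunctional_X_pow, hm _ le_rfl, hc]
    simp only [e1, e2, e3, e4]
    constructor <;> rintro ⟨h1, h2⟩ <;> constructor <;> linarith
  · have hH := hankelConditions_two_mul_iff (k := k + 1) (extend u c)
    rw [hH, ← hLdef, schur (w := 1) (by simp) (by omega), schur one_sub_X_sq_nonneg (by omega),
      fUp_two_mul_add_one, fLow_two_mul_add_one]
    have e1 : ∀ i : Fin k, L ((1 - X ^ 2) * X ^ k * X ^ (i : ℕ)) =
        mom u (k + i) - mom u (k + i + 2) := by
      intro i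
      rw [show ((1 - X ^ 2) * X ^ k * X ^ (i : ℕ) : ℝ[X]) =
        X ^ (k + i : ℕ) - X ^ (k + i + 2 : ℕ) by
        ring, map_sub, hLdef, momentFunctional_X_pow, momentFunctional_X_pow, hm _ (by omega),
        hm _ (by omega)]
    have e2 : ∀ i : Fin (k + 1), L (1 * X ^ (k + 1) * X ^ (i : ℕ)) = mom u (k + 1 + i) := by
      intro i
      rw [one_mul, ← pow_add, hLdef, momentFunctional_X_pow, hm _ (by omega)]
    have e3 : L ((1 - X ^ 2) * X ^ (k + k)) = mom u (2 * k) - c := by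
      rw [show ((1 - X ^ 2) * X ^ (k + k) : ℝ[X]) = X ^ (2 * k) - X ^ (2 * k + 1 + 1) by ring,
        map_sub, hLdef, momentFunctional_X_pow, momentFunctional_X_pow, hm _ (by omega), hc]
    have e4 : L (1 * X ^ (k + 1 + (k + 1))) = c := by
      rw [one_mul, show k + 1 + (k + 1) = 2 * k + 1 + 1 by ring, hLdef, momentFunctional_X_pow, hc]
    simp only [e1, e2, e3, e4]
    constructor <;> rintro ⟨h1, h2⟩ <;> constructor <;> linarith

theorem exists_extend_mem_realizableSet {N : ℕ} {u : Fin (N + 1) → ℝ} (hu : u ∈ realizableSet N) :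
    ∃ c, extend u c ∈ realizableSet (N + 1) := by
  obtain ⟨ψ, hfin, hpos, hψ⟩ := hu
  refine ⟨∫ x, (x : ℝ) ^ (N + 1) ∂ψ, ψ, hfin, hpos, fun i => ?_⟩
  induction i using Fin.lastCases with
  | last => rw [extend, Fin.snoc_last, Fin.val_last]
  | cast i => rw [extend, Fin.snoc_castSucc, hψ, Fin.val_castSucc]

theorem extend_zero {N : ℕ} (u : Fin (N + 1) → ℝ) (c : ℝ) : extend u c 0 = u 0 :=
  Fin.snoc_castSucc (α := fun _ => ℝ) c u 0

end FullMoment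

end

theorem mainTheorem2 (N : ℕ) (u : Fin (N + 1) → ℝ) (hu : u ∈ FullMoment.realizableSet N) :
    FullMoment.fLow u ≤ FullMoment.fUp u ∧
    ∀ c : ℝ,
      (FullMoment.extend u c ∈ FullMoment.realizableSet (N + 1) ↔
        FullMoment.fUp u ≥ c ∧ c ≥ FullMoment.fLow u) ∧
      (FullMoment.HankelConditions (FullMoment.extend u c) ↔
        FullMoment.fUp u ≥ c ∧ c ≥ FullMoment.fLow u) := by
  have hHankel := FullMoment.hankelConditions_extend_iff hu
  refine ⟨?_, fun c => ⟨?_, hHankel c⟩⟩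
  · obtain ⟨c, hc⟩ := FullMoment.exists_extend_mem_realizableSet hu
    obtain ⟨h1, h2⟩ := (hHankel c).mp (FullMoment.hankelConditions_of_mem_realizableSet hc)
    exact h2.trans h1
  · rw [← hHankel c, FullMoment.mem_realizableSet_iff]
    rw [FullMoment.extend_zero]
    exact FullMoment.zero_lt_of_mem_realizableSet hu
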